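/- Let $\frac13<H<\frac12$, $r=\frac1{2H}$ and $p\in\left(\frac1H,\frac1{1-2H}\right)$. For $T>0$ let $\mathcal W=\{\omega\in C([0,T],\mathbb R):\omega(0)=0\}$ with the supremum norm, let $\mathbb P$ be the law on $\mathcal W$ of fractional Brownian motion with Hurst parameter $H$, i.e. the Gaussian measure whose coordinate process is centred with covariance $R(s,t)=\frac12\left(s^{2H}+t^{2H}-|t-s|^{2H}\right)$. Let $\mathcal H\subset\mathcal W$ be its Cameron–Martin space: the set of all $Jf=\int_{\mathcal W}\omega f(\omega)\,d\mathbb P(\omega)$ with $f$ in the closure of $\mathcal W^*$ in $L^2(\mathbb P)$, with inner product $\langle Jf,Jg\rangle_{\mathcal H}=\langle f,g\rangle_{L^2(\mathbb P)}$; it contains $R(t,\cdot)$ for each $t\in[0,T]$. For partitions $\Pi=\{0=s_0<\dots<s_M=T\}$ and $\Psi=\{0=t_0<\dots<t_N=T\}$, with mesh $|\Pi|=\max_i(s_i-s_{i-1})$, put $$\|f\|_p=\sup_{\Pi}\Big(\sum_i|f(s_i)-f(s_{i-1})|^p\Big)^{1/p},\qquad \|F\|_r^{(2D)}=\sup_{\Pi,\Psi}\Big(\sum_{i,j}|\Delta_{ij}F|^r\Big)^{1/r},$$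 where $\Delta_{ij}F=F(s_i,t_j)-F(s_i,t_{j-1})-F(s_{i-1},t_j)+F(s_{i-1},t_{j-1})$. Let $\mathcal W_p$ be the closure in the norm $\|\cdot\|_p$ of the $C^\infty$ functions on $[0,T]$ that vanish at $0$. Young integrals are limits of Riemann sums: $\int_0^T f\,dg=\lim\sum_i f(c_i)\,(g(s_i)-g(s_{i-1}))$ with arbitrary $c_i\in(s_{i-1},s_i)$, as the mesh tends to $0$, and $\int_{[0,T]^2}F\,dG=\lim\sum_{i,j}F(c_i,d_j)\,\Delta_{ij}G$ with arbitrary $c_i\in(s_{i-1},s_i)$, $d_j\in(t_{j-1},t_j)$, as $|\Pi|\vee|\Psi|$ tends to $0$. Then $\|R\|_r^{(2D)}<\infty$, and there is a constant $C>0$, depending only on $p$ and $H$, such that the following holds for all $T>0$ and all $\alpha\in\mathcal W_p$. There is an element of $\mathcal H$, denoted $\int_0^T\alpha(t)R(dt,\cdot)$, such that for every sequence of partitions $\Pi_k=\{t_i\}$ of $[0,T]$ with mesh tending to $0$ and every choice of points $c_i\in(t_{i-1},t_i)$, the sums $$S_{\Pi_k}=\sum_i\alpha(c_i)\left[R(t_i,\cdot)-R(t_{i-1},\cdot)\right]$$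 converge to it in $\mathcal H$. Moreover, all the Young integrals below exist and 1. $\left\|\int_0^T\alpha(t)R(dt,\cdot)\right\|_{\mathcal H}^2=\int_{[0,T]^2}\alpha\otimes\alpha\,dR$, where $(\alpha\otimes\alpha)(s,t)=\alpha(s)\alpha(t)$, and $\left\|\int_0^T\alpha(t)R(dt,\cdot)\right\|_{\mathcal H}^2\le C\,\|\alpha\|_p^2\,\|R\|_r^{(2D)}$; 2. for each $h\in\mathcal H$, $\left\langle\int_0^T\alpha(t)R(dt,\cdot),h\right\rangle_{\mathcal H}=\int_0^T\alpha(t)\,dh(t)$; 3. for each $s\in[0,T]$, $\left(\int_0^T\alpha(t)R(dt,\cdot)\right)(s)=\int_0^T\alpha(t)\,R(dt,s)$. -/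

import Mathlib

open MeasureTheory ProbabilityTheory Filter Topology


noncomputable section

/-! ### The Cameron-Martin space of a Gaussian measure -/

section CameronMartin

variable {E : Type*} [NormedAddCommGroup E] [NormedSpace ℝ E] [CompleteSpace E]
  [SecondCountableTopology E] [MeasurableSpace E] [BorelSpace E]

theorem integrable_Lp_smul (μ : Measure E) [IsGaussian μ] (f : Lp ℝ 2 μ) :
    Integrable (fun w => f w • w) μ :=
  memLp_one_iff_integrable.1
    (MemLp.smul (r := 1) (IsGaussian.memLp_two_id (μ := μ)) (Lp.memLp f))

/-- The operator `J f = ∫ w f(w) dμ(w)` from `L²(μ)` to `E` (a Bochner integral). -/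
def gaussJ (μ : Measure E) [IsGaussian μ] : Lp ℝ 2 μ →ₗ[ℝ] E where
  toFun f := ∫ w, f w • w ∂μ
  map_add' f g := by
    rw [← integral_add (integrable_Lp_smul μ f) (integrable_Lp_smul μ g)]
    refine integral_congr_ae ?_
    filter_upwards [Lp.coeFn_add f g] with w h
    rw [h, Pi.add_apply, add_smul]
  map_smul' c f := by
    rw [RingHom.id_apply, ← integral_smul]
    refine integral_congr_ae ?_
    filter_upwards [Lp.coeFn_smul c f] with w h
    rw [h, Pi.smul_apply, smul_eq_mul, mul_smul]

/-- The closure in `L²(μ)` of the dual `E*`. -/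
def dualClosure (μ : Measure E) : Submodule ℝ (Lp ℝ 2 μ) :=
  (LinearMap.range (StrongDual.toLp (𝕜 := ℝ) μ 2).toLinearMap).topologicalClosure

theorem coeFn_toLp_dual (μ : Measure E) [IsGaussian μ] (L : StrongDual ℝ E) :
    StrongDual.toLp μ 2 L =ᵐ[μ] L := by
  rw [StrongDual.toLp_apply IsGaussian.memLp_two_id]
  exact MemLp.coeFn_toLp _

theorem dual_gaussJ (μ : Measure E) [IsGaussian μ] (L : StrongDual ℝ E) (f : Lp ℝ 2 μ) :
    L (gaussJ μ f) = inner ℝ (StrongDual.toLp μ 2 L) f := by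
  rw [L2.inner_def]
  change L (∫ w, f w • w ∂μ) = _
  rw [← L.integral_comp_comm (integrable_Lp_smul μ f)]
  refine integral_congr_ae ?_
  filter_upwards [coeFn_toLp_dual μ L] with w h
  rw [h]
  simp

theorem gaussJ_injOn (μ : Measure E) [IsGaussian μ] :
    Function.Injective ((gaussJ μ).domRestrict (dualClosure μ)) := by
  rw [← LinearMap.ker_eq_bot, LinearMap.ker_eq_bot']
  rintro ⟨f, hf⟩ h
  replace h : gaussJ μ f = 0 := h
  have hsub : dualClosure μ ≤ (ℝ ∙ f)ᗮ := by
    refine Submodule.topologicalClosure_minimal _ ?_ (Submodule.isClosed_orthogonal _)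
    rintro _ ⟨L, rfl⟩
    rw [Submodule.mem_orthogonal_singleton_iff_inner_left]
    have := dual_gaussJ μ L f
    rw [h, map_zero] at this
    exact this.symm
  have := Submodule.mem_orthogonal_singleton_iff_inner_left.1 (hsub hf)
  exact Subtype.ext (inner_self_eq_zero.1 this)

/-- The Cameron-Martin space of a (centred) Gaussian measure `μ`: the set of all `J f` with `f` in
the `L²(μ)`-closure of `E*`. It is a type of its own, because its norm is not the one of `E`. -/
def CameronMartin (μ : Measure E) [IsGaussian μ] : Type _ :=
  ↥(LinearMap.range ((gaussJ μ).domRestrict (dualClosure μ)))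

namespace CameronMartin

variable (μ : Measure E) [IsGaussian μ]

instance : AddCommGroup (CameronMartin μ) :=
  inferInstanceAs
    (AddCommGroup ↥(LinearMap.range ((gaussJ μ).domRestrict (dualClosure μ))))

instance : Module ℝ (CameronMartin μ) :=
  inferInstanceAs
    (Module ℝ ↥(LinearMap.range ((gaussJ μ).domRestrict (dualClosure μ))))

/-- The inclusion of the Cameron-Martin space in `E`. -/
def incl : CameronMartin μ →ₗ[ℝ] E :=
  (LinearMap.range ((gaussJ μ).domRestrict (dualClosure μ))).subtype

/-- The inverse of the bijection `f ↦ J f` from the closure of `E*` to the Cameron-Martin space. -/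
def preJ : CameronMartin μ ≃ₗ[ℝ] ↥(dualClosure μ) :=
  (LinearEquiv.ofInjective _ (gaussJ_injOn μ)).symm

instance : NormedAddCommGroup (CameronMartin μ) :=
  NormedAddCommGroup.induced _ _ (preJ μ) (preJ μ).injective

/-- The inner product is `⟨J f, J g⟩ = ⟨f, g⟩_{L²(μ)}`. -/
instance : InnerProductSpace ℝ (CameronMartin μ) where
  norm_smul_le c h := by
    change ‖preJ μ (c • h)‖ ≤ ‖c‖ * ‖preJ μ h‖
    rw [map_smul, norm_smul]
  inner h k := inner ℝ (preJ μ h) (preJ μ k)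
  norm_sq_eq_re_inner h := norm_sq_eq_re_inner (𝕜 := ℝ) (preJ μ h)
  conj_inner_symm h k := inner_conj_symm (preJ μ h) (preJ μ k)
  add_left h k l := by
    change inner ℝ (preJ μ (h + k)) (preJ μ l) = _
    rw [map_add, inner_add_left]
  smul_left h k c := by
    change inner ℝ (preJ μ (c • h)) (preJ μ k) = _
    rw [map_smul]
    exact inner_smul_left (preJ μ h) (preJ μ k) c

theorem gaussJ_preJ (h : CameronMartin μ) : gaussJ μ (preJ μ h : Lp ℝ 2 μ) = incl μ h :=
  congrArg Subtype.val ((LinearEquiv.ofInjective _ (gaussJ_injOn μ)).apply_symm_apply h)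

theorem inner_eq (h k : CameronMartin μ) :
    inner ℝ h k = inner ℝ (preJ μ h : Lp ℝ 2 μ) (preJ μ k : Lp ℝ 2 μ) := rfl

end CameronMartin

end CameronMartin

/-! ### Wiener space and the law of fractional Brownian motion -/

/-- The Banach space of continuous `w : [0,T] → ℝ` with `w(0) = 0`, under the supremum norm. -/
def WienerSpace (T : ℝ) : Submodule ℝ C(Set.Icc (0 : ℝ) T, ℝ) where
  carrier := {w | ∀ s : Set.Icc (0 : ℝ) T, (s : ℝ) = 0 → w s = 0}
  add_mem' h k s hs := by simp [h s hs, k s hs]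
  zero_mem' _ _ := rfl
  smul_mem' c _ h s hs := by simp [h s hs]

instance (T : ℝ) : CoeFun (WienerSpace T) (fun _ => Set.Icc (0 : ℝ) T → ℝ) := ⟨fun w => w.1⟩

instance (T : ℝ) : MeasurableSpace (WienerSpace T) := borel _

instance (T : ℝ) : BorelSpace (WienerSpace T) := ⟨rfl⟩

instance (T : ℝ) : CompleteSpace (WienerSpace T) := by
  refine IsClosed.completeSpace_coe (s := (WienerSpace T : Set C(Set.Icc (0 : ℝ) T, ℝ))) (hs := ?_)
  have : (WienerSpace T : Set C(Set.Icc (0 : ℝ) T, ℝ)) =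
      ⋂ s : Set.Icc (0 : ℝ) T, ⋂ _ : (s : ℝ) = 0, {w | w s = 0} := by
    ext w
    simp [WienerSpace]
  rw [this]
  exact isClosed_iInter fun s => isClosed_iInter fun _ =>
    isClosed_eq (continuous_eval_const s) continuous_const

/-- Evaluation at time `s`, as a continuous linear functional. -/
def evalW {T : ℝ} (s : Set.Icc (0 : ℝ) T) : StrongDual ℝ (WienerSpace T) :=
  (ContinuousMap.evalCLM ℝ s).comp (WienerSpace T).subtypeL

/-- The covariance of fractional Brownian motion with Hurst parameter `H`. -/
def fbmCov (H s t : ℝ) : ℝ := (s ^ (2 * H) + t ^ (2 * H) - |t - s| ^ (2 * H)) / 2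

/-- `P` is the law on `WienerSpace T` of fractional Brownian motion with Hurst parameter `H`:
a Gaussian measure under which the coordinate process is centred with covariance `fbmCov H`. -/
structure IsFBMLaw (H : ℝ) {T : ℝ} (P : Measure (WienerSpace T)) [IsGaussian P] : Prop where
  mean_zero : ∀ t, ∫ w, w t ∂P = 0
  cov : ∀ s t, ∫ w, w s * w t ∂P = fbmCov H s t

/-- The path `R(t, ·)`. -/
def covPath {H : ℝ} (hH : 0 < H) {T : ℝ} (t : Set.Icc (0 : ℝ) T) : WienerSpace T :=
  ⟨⟨fun s => fbmCov H t s, by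
    have h : 0 ≤ 2 * H := by linarith
    unfold fbmCov
    refine Continuous.div_const (Continuous.sub (Continuous.add continuous_const ?_) ?_) _
    · exact continuous_subtype_val.rpow_const fun _ => Or.inr h
    · exact (continuous_subtype_val.sub continuous_const).abs.rpow_const fun _ => Or.inr h⟩, by
    intro s hs
    have h : 2 * H ≠ 0 := by linarith
    have ht : |(t : ℝ)| = t := abs_of_nonneg t.2.1
    simp [fbmCov, hs, Real.zero_rpow h, ht]⟩

theorem gaussJ_eval {H : ℝ} (hH : 0 < H) {T : ℝ} {P : Measure (WienerSpace T)} [IsGaussian P]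
    (hP : IsFBMLaw H P) (t : Set.Icc (0 : ℝ) T) :
    gaussJ P (StrongDual.toLp P 2 (evalW t)) = covPath hH t := by
  refine Subtype.ext (ContinuousMap.ext fun s => ?_)
  change evalW s (gaussJ P (StrongDual.toLp P 2 (evalW t))) = fbmCov H t s
  refine (dual_gaussJ P (evalW s) _).trans ?_
  rw [L2.inner_def, ← hP.cov t s]
  refine integral_congr_ae ?_
  filter_upwards [coeFn_toLp_dual P (evalW s), coeFn_toLp_dual P (evalW t)] with w h k
  rw [h, k]
  rfl

/-- `R(t, ·)` as an element of the Cameron-Martin space of the law of fractional Brownian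
motion. -/
def covElem {H : ℝ} (hH : 0 < H) {T : ℝ} {P : Measure (WienerSpace T)} [IsGaussian P]
    (hP : IsFBMLaw H P) (t : Set.Icc (0 : ℝ) T) : CameronMartin P :=
  ⟨covPath hH t, by
    have hm : StrongDual.toLp P 2 (evalW t) ∈ dualClosure P :=
      Submodule.le_topologicalClosure _ ⟨evalW t, rfl⟩
    exact ⟨⟨_, hm⟩, gaussJ_eval hH hP t⟩⟩

/-! ### Partitions, variation norms, Young integrals -/

/-- A finite partition `0 = t₀ < t₁ < ⋯ < t_N = T` of `[0,T]`. -/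
structure Partn (T : ℝ) where
  N : ℕ
  pt : Fin (N + 1) → Set.Icc (0 : ℝ) T
  strictMono : StrictMono pt
  pt_zero : (pt 0 : ℝ) = 0
  pt_last : (pt (Fin.last N) : ℝ) = T

/-- The mesh size of a partition. -/
def Partn.mesh {T : ℝ} (π : Partn T) : ℝ :=
  ⨆ i : Fin π.N, ((π.pt i.succ : ℝ) - π.pt i.castSucc)

/-- A partition with a point `c_i` in each open interval `(t_{i-1}, t_i)`. -/
structure TaggedPartn (T : ℝ) extends Partn T where
  tag : Fin N → Set.Icc (0 : ℝ) T
  tag_mem : ∀ i, tag i ∈ Set.Ioo (pt i.castSucc) (pt i.succ)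

/-- The increment of `f` over the `i`-th interval of the partition. -/
def Partn.incr {T : ℝ} {V : Type*} [AddCommGroup V] (π : Partn T) (f : Set.Icc (0 : ℝ) T → V)
    (i : Fin π.N) : V :=
  f (π.pt i.succ) - f (π.pt i.castSucc)

/-- The rectangular increment of `F` over the product of the `i`-th interval of `π` and the
`j`-th interval of `ψ`. -/
def rectIncr {T : ℝ} (π ψ : Partn T) (F : Set.Icc (0 : ℝ) T → Set.Icc (0 : ℝ) T → ℝ)
    (i : Fin π.N) (j : Fin ψ.N) : ℝ :=
  F (π.pt i.succ) (ψ.pt j.succ) - F (π.pt i.succ) (ψ.pt j.castSucc)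
    - F (π.pt i.castSucc) (ψ.pt j.succ) + F (π.pt i.castSucc) (ψ.pt j.castSucc)

/-- The `p`-variation `‖f‖_p`, with value `∞` if the supremum is infinite. -/
def pVar {T : ℝ} (p : ℝ) (f : Set.Icc (0 : ℝ) T → ℝ) : ENNReal :=
  ⨆ π : Partn T, ENNReal.ofReal ((∑ i, |π.incr f i| ^ p) ^ (1 / p))

/-- The two-dimensional `p`-variation `‖F‖_p^{(2D)}`, with value `∞` if the supremum is
infinite. -/
def pVar2D {T : ℝ} (p : ℝ) (F : Set.Icc (0 : ℝ) T → Set.Icc (0 : ℝ) T → ℝ) : ENNReal :=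
  ⨆ (π : Partn T) (ψ : Partn T),
    ENNReal.ofReal ((∑ i, ∑ j, |rectIncr π ψ F i j| ^ p) ^ (1 / p))

/-- The space `𝒲_p`: the closure in `p`-variation norm of the smooth functions on `[0,T]` that
vanish at `0`. -/
def Wp (T p : ℝ) : Set (WienerSpace T) :=
  {α | pVar p α ≠ ⊤ ∧ ∀ ε : ENNReal, 0 < ε → ∃ f : WienerSpace T,
    (∃ F : ℝ → ℝ, ContDiffOn ℝ (⊤ : ℕ∞) F (Set.Icc 0 T) ∧ ∀ s, f s = F s) ∧
    pVar p (fun s => α s - f s) < ε}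

/-- `I` is the Young integral `∫ f dg`: along every sequence of tagged partitions whose mesh size
tends to `0`, the sums `∑ f(c_i) (g(t_i) - g(t_{i-1}))` converge to `I`. -/
def IsYoungIntegral {T : ℝ} (f g : Set.Icc (0 : ℝ) T → ℝ) (I : ℝ) : Prop :=
  ∀ π : ℕ → TaggedPartn T, Tendsto (fun k => (π k).mesh) atTop (𝓝 0) →
    Tendsto (fun k => ∑ i, f ((π k).tag i) * (π k).incr g i) atTop (𝓝 I)

/-- `I` is the two-dimensional Young integral `∫ F dG` over `[0,T]²`. -/
def IsYoungIntegral2D {T : ℝ} (F G : Set.Icc (0 : ℝ) T → Set.Icc (0 : ℝ) T → ℝ) (I : ℝ) : Prop :=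
  ∀ π ψ : ℕ → TaggedPartn T,
    Tendsto (fun k => max (π k).mesh (ψ k).mesh) atTop (𝓝 0) →
    Tendsto (fun k => ∑ i, ∑ j, F ((π k).tag i) ((ψ k).tag j) *
      rectIncr (π k).toPartn (ψ k).toPartn G i j) atTop (𝓝 I)

/-- The Riemann sum `S_Π = ∑ α(c_i) [R(t_i, ·) - R(t_{i-1}, ·)]` in the Cameron-Martin space. -/
def riemannSum {H : ℝ} (hH : 0 < H) {T : ℝ} {P : Measure (WienerSpace T)} [IsGaussian P]
    (hP : IsFBMLaw H P) (α : WienerSpace T) (π : TaggedPartn T) : CameronMartin P :=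
  ∑ i, α (π.tag i) • π.incr (covElem hH hP) i

end

/-! ### Sums over partitions -/

/-! The whole argument takes place in the Hilbert space $\mathcal H$, where $t\mapsto R(t,\cdot)$ is
a path with the reproducing property. Pairing a Riemann sum $S_\Pi$ with $h$ gives the Riemann sum
of $\int\alpha\,dh$ (`inner_riemannSum`), and pairing two Riemann sums gives the two-dimensional sum
of $\int\alpha\otimes\alpha\,dR$. Once $S_\Pi$ converges in norm, all three formulas follow from
continuity of the inner product.

Convergence rests on a bound uniform in the partition. The variation of $R(b,\cdot)-R(a,\cdot)$ is
at most $2(b-a)^{2H}$ (`sum_abs_fbmCov_le`), so the path of $S_\Pi$ is $2H$-Hölder with constant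
$2\|\alpha\|_p$. Now $\|S_\Pi\|^2$ is the Riemann sum of $\alpha$ against this very path, and a
one-dimensional discrete Love–Young inequality (`abs_sum_sub_le_of_pVar`), valid as $1/p+2H>1$,
gives $\|S_\Pi\|^2\le C\|\alpha\|_p^2T^{2H}$ (`norm_riemannSum_sq_le`). For smooth integrands the
sums converge by integration by parts in $\mathcal H$; density in $\mathcal W_p$ and the uniform
bound transfer this to $\alpha$. -/

theorem Fin.sum_succ_sub_castSucc {V : Type*} [AddCommGroup V] :
    ∀ {n : ℕ} (f : Fin (n + 1) → V),
      ∑ i : Fin n, (f i.succ - f i.castSucc) = f (Fin.last n) - f 0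
  | 0, f => by simp
  | n + 1, f => by
    rw [Fin.sum_univ_succ]
    have h := Fin.sum_succ_sub_castSucc (fun i : Fin (n + 1) => f i.succ)
    simp only [Fin.succ_castSucc, Fin.succ_last] at h
    simp only [Fin.castSucc_zero]
    rw [h]
    abel

namespace Partn

variable {T : ℝ} (π : Partn T)

theorem castSucc_le_succ (i : Fin π.N) : (π.pt i.castSucc : ℝ) ≤ π.pt i.succ :=
  (π.strictMono i.castSucc_lt_succ).le

theorem nonneg {T : ℝ} (π : Partn T) : 0 ≤ T := by
  rw [← π.pt_last]
  exact (π.pt (Fin.last π.N)).2.1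

theorem sum_incr {V : Type*} [AddCommGroup V] (f : Set.Icc (0 : ℝ) T → V) :
    ∑ i, π.incr f i = f ⟨T, π.nonneg, le_rfl⟩ - f ⟨0, le_rfl, π.nonneg⟩ := by
  unfold incr
  rw [Fin.sum_succ_sub_castSucc (fun i => f (π.pt i))]
  congr 2
  · exact Subtype.ext π.pt_last
  · exact Subtype.ext π.pt_zero

theorem sum_length : ∑ i : Fin π.N, ((π.pt i.succ : ℝ) - π.pt i.castSucc) = T := by
  have h := π.sum_incr (fun s => (s : ℝ))
  simpa [incr] using h

theorem length_le_mesh (i : Fin π.N) : (π.pt i.succ : ℝ) - π.pt i.castSucc ≤ π.mesh :=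
  le_ciSup (f := fun i : Fin π.N => (π.pt i.succ : ℝ) - π.pt i.castSucc)
    (Set.finite_range _).bddAbove i

theorem mesh_nonneg : 0 ≤ π.mesh :=
  Real.iSup_nonneg fun i => sub_nonneg.2 (π.castSucc_le_succ i)

/-- The variation of the sum of a monotone and an antitone function along a partition. -/
theorem sum_abs_incr_add_le {M A : ℝ → ℝ} (hM : Monotone M) (hA : Antitone A) :
    ∑ i, |π.incr (fun s => M s + A s) i| ≤ (M T - M 0) + (A 0 - A T) := by
  have h := π.sum_incr (fun s => M s - A s)
  calc ∑ i, |π.incr (fun s => M s + A s) i|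
      ≤ ∑ i, π.incr (fun s => M s - A s) i := by
        refine Finset.sum_le_sum fun i _ => ?_
        have h1 := hM (π.castSucc_le_succ i)
        have h2 := hA (π.castSucc_le_succ i)
        simp only [incr]
        rw [abs_le]
        constructor <;> linarith
    _ = _ := by rw [h]; ring

end Partn

/-! ### The covariance of fractional Brownian motion -/

/-- Concavity: $v$ and $u+d$ are convex combinations of $u$ and $v+d$ with the two weights
interchanged. Adding the two concavity inequalities gives the claim. -/
theorem rpow_add_sub_rpow_antitone {γ : ℝ} (h0 : 0 ≤ γ) (h1 : γ ≤ 1) {d u v : ℝ} (hd : 0 ≤ d)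
    (hu : 0 ≤ u) (huv : u ≤ v) : (v + d) ^ γ - v ^ γ ≤ (u + d) ^ γ - u ^ γ := by
  rcases (add_nonneg (sub_nonneg.2 huv) hd).eq_or_lt with h | h
  · have : v = u := by linarith
    rw [this]
  have hc := Real.concaveOn_rpow h0 h1
  have hl : 0 ≤ d / (v - u + d) := by positivity
  have hl' : 0 ≤ (v - u) / (v - u + d) := div_nonneg (by linarith) h.le
  have hs : d / (v - u + d) + (v - u) / (v - u + d) = 1 := by field_simp; ring
  have hu' : u ∈ Set.Ici (0 : ℝ) := hu
  have hv' : v + d ∈ Set.Ici (0 : ℝ) := by simp only [Set.mem_Ici]; linarith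
  have e1 := hc.2 hu' hv' hl hl' hs
  have e2 := hc.2 hv' hu' hl hl' hs
  simp only [smul_eq_mul] at e1 e2
  have i1 : d / (v - u + d) * u + (v - u) / (v - u + d) * (v + d) = v := by field_simp; ring
  have i2 : d / (v - u + d) * (v + d) + (v - u) / (v - u + d) * u = u + d := by field_simp; ring
  rw [i1] at e1
  rw [i2] at e2
  have : d / (v - u + d) * u ^ γ + (v - u) / (v - u + d) * (v + d) ^ γ
      + (d / (v - u + d) * (v + d) ^ γ + (v - u) / (v - u + d) * u ^ γ)
      = (d / (v - u + d) + (v - u) / (v - u + d)) * (u ^ γ + (v + d) ^ γ) := by ring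
  rw [hs] at this
  linarith

/-- The function `t ↦ |t-a|^γ - |t-b|^γ` has total variation at most `4 (b-a)^γ`. -/
theorem Partn.sum_abs_incr_rpow_sub_le {γ : ℝ} (h0 : 0 < γ) (h1 : γ ≤ 1) {T a b : ℝ} (hab : a ≤ b)
    (π : Partn T) :
    ∑ i, |π.incr (fun s => |(s : ℝ) - a| ^ γ - |(s : ℝ) - b| ^ γ) i| ≤ 4 * (b - a) ^ γ := by
  set d := b - a with hd
  have hd0 : 0 ≤ d := sub_nonneg.2 hab
  let ψ : ℝ → ℝ := fun u => u ^ γ - (u + d) ^ γ + d ^ γ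
  have ψ0 : ψ 0 = 0 := by simp [ψ, Real.zero_rpow h0.ne']
  have ψmono : ∀ u v, 0 ≤ u → u ≤ v → ψ u ≤ ψ v := fun u v hu huv => by
    have := rpow_add_sub_rpow_antitone h0.le h1 hd0 hu huv
    simp only [ψ]
    linarith
  have ψnonneg : ∀ u, 0 ≤ u → 0 ≤ ψ u := fun u hu => ψ0 ▸ ψmono 0 u le_rfl hu
  have ψle : ∀ u, 0 ≤ u → ψ u ≤ d ^ γ := fun u hu => by
    have : u ^ γ ≤ (u + d) ^ γ := Real.rpow_le_rpow hu (by linarith) h0.le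
    simp only [ψ]
    linarith
  let c : ℝ → ℝ := fun t => max a (min b t)
  have ca : ∀ t, a ≤ c t := fun t => le_max_left _ _
  have cb : ∀ t, c t ≤ b := fun t => max_le hab (min_le_left _ _)
  have cmono : Monotone c := fun s t hst => max_le_max le_rfl (min_le_min le_rfl hst)
  -- The function falls up to $a$, rises on $[a,b]$ and falls after $b$. `M` carries the rise and
  -- `A` the two falls, each fall being expressed by `ψ`, which increases from $0$ and stays below
  -- $d^\gamma$.
  let M : ℝ → ℝ := fun t => (c t - a) ^ γ - (b - c t) ^ γ
  let A : ℝ → ℝ := fun t => ψ (max (a - t) 0) - ψ (max (t - b) 0)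
  have hM : Monotone M := fun s t hst => by
    have e1 : (c s - a) ^ γ ≤ (c t - a) ^ γ :=
      Real.rpow_le_rpow (sub_nonneg.2 (ca s)) (by linarith [cmono hst]) h0.le
    have e2 : (b - c t) ^ γ ≤ (b - c s) ^ γ :=
      Real.rpow_le_rpow (sub_nonneg.2 (cb t)) (by linarith [cmono hst]) h0.le
    simp only [M]
    linarith
  have hA : Antitone A := fun s t hst => by
    have e1 := ψmono (max (a - t) 0) (max (a - s) 0) (le_max_right _ _)
      (max_le_max (by linarith) le_rfl)
    have e2 := ψmono (max (s - b) 0) (max (t - b) 0) (le_max_right _ _)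
      (max_le_max (by linarith) le_rfl)
    simp only [A]
    linarith
  have key : (fun s : Set.Icc (0 : ℝ) T => |(s : ℝ) - a| ^ γ - |(s : ℝ) - b| ^ γ)
      = fun s : Set.Icc (0 : ℝ) T => M s + A s := by
    funext s
    generalize (s : ℝ) = t
    rcases le_total t a with hta | hta
    · have hct : c t = a := by simp only [c]; rw [min_eq_right (hta.trans hab), max_eq_left hta]
      have e1 : max (a - t) 0 = a - t := max_eq_left (by linarith)
      have e2 : max (t - b) 0 = 0 := max_eq_right (by linarith)
      simp only [M, A, hct, e1, e2, ψ0, ψ]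
      rw [abs_of_nonpos (by linarith), abs_of_nonpos (by linarith), sub_self,
        Real.zero_rpow h0.ne', ← hd, show a - t + d = b - t by rw [hd]; ring, neg_sub, neg_sub]
      ring
    · rcases le_total t b with htb | htb
      · have hct : c t = t := by simp only [c]; rw [min_eq_right htb, max_eq_right hta]
        have e1 : max (a - t) 0 = 0 := max_eq_right (by linarith)
        have e2 : max (t - b) 0 = 0 := max_eq_right (by linarith)
        simp only [M, A, hct, e1, e2, ψ0]
        rw [abs_of_nonneg (by linarith), abs_of_nonpos (by linarith), neg_sub]
        ring
      · have hct : c t = b := by simp only [c]; rw [min_eq_left htb, max_eq_right hab]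
        have e1 : max (a - t) 0 = 0 := max_eq_right (by linarith)
        have e2 : max (t - b) 0 = t - b := max_eq_left (by linarith)
        simp only [M, A, hct, e1, e2, ψ0, ψ]
        rw [abs_of_nonneg (by linarith), abs_of_nonneg (by linarith), sub_self,
          Real.zero_rpow h0.ne', ← hd, show t - b + d = t - a by rw [hd]; ring]
        ring
  rw [key]
  refine (π.sum_abs_incr_add_le hM hA).trans ?_
  -- Each of $M(T)$, $-M(0)$, $A(0)$, $-A(T)$ is at most $d^\gamma$, whence the factor 4.
  have m1 : M T ≤ d ^ γ := by
    have e1 : (c T - a) ^ γ ≤ d ^ γ :=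
      Real.rpow_le_rpow (sub_nonneg.2 (ca T)) (by linarith [cb T]) h0.le
    have e2 : 0 ≤ (b - c T) ^ γ := Real.rpow_nonneg (sub_nonneg.2 (cb T)) _
    simp only [M]
    linarith
  have m2 : -d ^ γ ≤ M 0 := by
    have e1 : (b - c 0) ^ γ ≤ d ^ γ :=
      Real.rpow_le_rpow (sub_nonneg.2 (cb 0)) (by linarith [ca 0]) h0.le
    have e2 : 0 ≤ (c 0 - a) ^ γ := Real.rpow_nonneg (sub_nonneg.2 (ca 0)) _
    simp only [M]
    linarith
  have a1 : A 0 ≤ d ^ γ := by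
    have := ψle (max (a - 0) 0) (le_max_right _ _)
    have := ψnonneg (max (0 - b) 0) (le_max_right _ _)
    simp only [A]
    linarith
  have a2 : -d ^ γ ≤ A T := by
    have := ψnonneg (max (a - T) 0) (le_max_right _ _)
    have := ψle (max (T - b) 0) (le_max_right _ _)
    simp only [A]
    linarith
  linarith

/-- The rectangular increments of `fbmCov H` over `[a,b] × ψ`. -/
theorem sum_abs_fbmCov_le {H : ℝ} (hH : 0 < H) (hH' : H ≤ 1 / 2) {T : ℝ} (ψ : Partn T)
    {a b : Set.Icc (0 : ℝ) T} (hab : a ≤ b) :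
    ∑ j : Fin ψ.N, |fbmCov H b (ψ.pt j.succ) - fbmCov H b (ψ.pt j.castSucc)
      - fbmCov H a (ψ.pt j.succ) + fbmCov H a (ψ.pt j.castSucc)|
      ≤ 2 * ((b : ℝ) - a) ^ (2 * H) := by
  have h := ψ.sum_abs_incr_rpow_sub_le (γ := 2 * H) (by linarith) (by linarith)
    (a := a) (b := b) hab
  -- The terms of $R$ that depend on one variable cancel in a rectangular increment.
  calc _ = ∑ j, 1 / 2 * |ψ.incr (fun s => |(s : ℝ) - a| ^ (2 * H) - |(s : ℝ) - b| ^ (2 * H)) j| := by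
        refine Finset.sum_congr rfl fun j _ => ?_
        rw [← abs_of_pos (show (0 : ℝ) < 1 / 2 by norm_num), ← abs_mul]
        congr 1
        simp only [Partn.incr, fbmCov]
        ring
    _ ≤ _ := by rw [← Finset.mul_sum]; linarith

/-- On a strip of width $\ell$ the increments have absolute sum at most $B=2\ell^{2H}$. Since
$r\ge1$, the sum of their $r$-th powers is at most $B^{r-1}B=2^r\ell$, which is additive over the
strips because $2Hr=1$. -/
theorem pVar2D_fbmCov_ne_top {H : ℝ} (hH : 0 < H) (hH' : H ≤ 1 / 2) (T : ℝ) :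
    pVar2D (T := T) (1 / (2 * H)) (fun s t => fbmCov H s t) ≠ ⊤ := by
  set r := 1 / (2 * H) with hr
  have hr1 : 1 ≤ r := by rw [hr, le_div_iff₀ (by linarith)]; linarith
  have hrH : 2 * H * r = 1 := by rw [hr]; field_simp
  refine ne_top_of_le_ne_top (b := ENNReal.ofReal ((2 ^ r * T) ^ (1 / r))) ENNReal.ofReal_ne_top ?_
  refine iSup_le fun π => iSup_le fun ψ => ENNReal.ofReal_le_ofReal ?_
  refine Real.rpow_le_rpow (by positivity) ?_ (by positivity)
  calc _ ≤ ∑ i : Fin π.N, 2 ^ r * ((π.pt i.succ : ℝ) - π.pt i.castSucc) := by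
        refine Finset.sum_le_sum fun i _ => ?_
        set B := 2 * ((π.pt i.succ : ℝ) - π.pt i.castSucc) ^ (2 * H) with hB
        have hl : 0 < (π.pt i.succ : ℝ) - π.pt i.castSucc :=
          sub_pos.2 (π.strictMono i.castSucc_lt_succ)
        have hB0 : 0 < B := by positivity
        have hs : ∑ j, |rectIncr π ψ (fun s t => fbmCov H s t) i j| ≤ B :=
          sum_abs_fbmCov_le hH hH' ψ (π.castSucc_le_succ i)
        have hBr : B ^ (r - 1) * B = 2 ^ r * ((π.pt i.succ : ℝ) - π.pt i.castSucc) := by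
          rw [Real.rpow_sub_one hB0.ne', div_mul_cancel₀ _ hB0.ne', hB,
            Real.mul_rpow (by norm_num) (by positivity), ← Real.rpow_mul hl.le, hrH, Real.rpow_one]
        rw [← hBr]
        refine le_trans ?_ (mul_le_mul_of_nonneg_left hs (by positivity))
        rw [Finset.mul_sum]
        refine Finset.sum_le_sum fun j _ => ?_
        have hj : |rectIncr π ψ (fun s t => fbmCov H s t) i j| ≤ B :=
          (Finset.single_le_sum (f := fun j => |rectIncr π ψ (fun s t => fbmCov H s t) i j|)
            (fun _ _ => abs_nonneg _) (Finset.mem_univ j)).trans hs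
        rcases (abs_nonneg (rectIncr π ψ (fun s t => fbmCov H s t) i j)).eq_or_lt with h0 | h0
        · rw [← h0, Real.zero_rpow (by linarith), mul_zero]
        · calc _ = |rectIncr π ψ (fun s t => fbmCov H s t) i j| ^ (r - 1)
                  * |rectIncr π ψ (fun s t => fbmCov H s t) i j| := by
                rw [Real.rpow_sub_one h0.ne', div_mul_cancel₀ _ h0.ne']
            _ ≤ _ := mul_le_mul_of_nonneg_right
                (Real.rpow_le_rpow (abs_nonneg _) hj (by linarith)) (abs_nonneg _)
    _ = _ := by rw [← Finset.mul_sum, π.sum_length]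

/-- The partition with the endpoints only. -/
def Partn.trivial {T : ℝ} (hT : 0 < T) : Partn T where
  N := 1
  pt := ![⟨0, le_rfl, hT.le⟩, ⟨T, hT.le, le_rfl⟩]
  strictMono := by
    rw [Fin.strictMono_iff_lt_succ]
    intro i
    fin_cases i
    exact hT
  pt_zero := rfl
  pt_last := rfl

/-- The single rectangle $[0,T]^2$ has increment $R(T,T)=T^{2H}$. This trades the power of $T$ in
the norm bound for $\|R\|_r^{(2D)}$, so that the constant does not depend on $T$. -/
theorem rpow_le_pVar2D_fbmCov {H : ℝ} (hH : 0 < H) (hH' : H ≤ 1 / 2) {T : ℝ} (hT : 0 < T) :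
    T ^ (2 * H) ≤ (pVar2D (T := T) (1 / (2 * H)) (fun s t => fbmCov H s t)).toReal := by
  rw [← ENNReal.ofReal_le_iff_le_toReal (pVar2D_fbmCov_ne_top hH hH' T)]
  refine le_trans ?_ (le_iSup₂ (f := fun π ψ : Partn T =>
    ENNReal.ofReal ((∑ i, ∑ j, |rectIncr π ψ (fun s t => fbmCov H s t) i j| ^ (1 / (2 * H)))
      ^ (1 / (1 / (2 * H))))) (Partn.trivial hT) (Partn.trivial hT))
  refine ENNReal.ofReal_le_ofReal (le_of_eq ?_)
  have hz : (0 : ℝ) ^ (2 * H) = 0 := Real.zero_rpow (by linarith)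
  have e : ∀ i j, rectIncr (Partn.trivial hT) (Partn.trivial hT) (fun s t => fbmCov H s t) i j
      = T ^ (2 * H) := by
    intro i j
    change Fin 1 at i
    change Fin 1 at j
    fin_cases i
    fin_cases j
    simp [rectIncr, Partn.trivial, fbmCov, hz, abs_of_pos hT]
  have hp : (0 : ℝ) < T ^ (2 * H) := by positivity
  simp only [e, Finset.sum_const, Finset.card_univ, Fintype.card_fin]
  simp only [Partn.trivial, one_smul]
  rw [← Real.rpow_mul (abs_nonneg _), mul_one_div_cancel (by positivity), Real.rpow_one,
    abs_of_pos hp]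

/-! ### A discrete Young inequality -/

/-- The increasing enumeration of the natural numbers other than `i + 1`. -/
def skipSucc (i k : ℕ) : ℕ := if k ≤ i then k else k + 1

theorem skipSucc_strictMono (i : ℕ) : StrictMono (skipSucc i) := by
  intro k l h
  simp only [skipSucc]
  split_ifs <;> omega

/-- Deleting the point $i+1$ merges two neighbouring cells and leaves the others intact. The length
$i+m+2$ lets the cells to the right be added by induction on $m$. -/
theorem sum_sub_sum_skipSucc (x y : ℕ → ℝ) (i m : ℕ) :
    ∑ k ∈ Finset.range (i + m + 2), x k * (y (k + 1) - y k)
      - ∑ k ∈ Finset.range (i + m + 1),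
        x (skipSucc i k) * (y (skipSucc i (k + 1)) - y (skipSucc i k))
      = (x (i + 1) - x i) * (y (i + 2) - y (i + 1)) := by
  induction m with
  | zero =>
    rw [add_zero, Finset.sum_range_succ, Finset.sum_range_succ, Finset.sum_range_succ _ i]
    have : ∑ k ∈ Finset.range i, x (skipSucc i k) * (y (skipSucc i (k + 1)) - y (skipSucc i k))
        = ∑ k ∈ Finset.range i, x k * (y (k + 1) - y k) := by
      refine Finset.sum_congr rfl fun k hk => ?_
      have hk := Finset.mem_range.1 hk
      simp only [skipSucc, if_pos hk.le, if_pos (Nat.succ_le_of_lt hk)]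
    rw [this]
    simp only [skipSucc, le_refl, if_true, if_neg (show ¬ i + 1 ≤ i by omega)]
    ring
  | succ m ih =>
    rw [show i + (m + 1) + 2 = (i + m + 2) + 1 by ring,
      show i + (m + 1) + 1 = (i + m + 1) + 1 by ring,
      Finset.sum_range_succ (fun k => x k * (y (k + 1) - y k)) (i + m + 2),
      Finset.sum_range_succ (fun k => x (skipSucc i k) *
        (y (skipSucc i (k + 1)) - y (skipSucc i k))) (i + m + 1), add_sub_add_comm, ih]
    simp only [skipSucc, if_neg (show ¬ i + m + 1 ≤ i by omega),
      if_neg (show ¬ i + m + 1 + 1 ≤ i by omega)]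
    ring

/-- The Love–Young inequality for finite sums: `x` has `p`-variation at most `V` and `y` is Hölder
continuous of exponent `γ` with respect to the times `t`. -/
theorem abs_sum_sub_le_of_pVar {p γ V K T : ℝ} (hp : 0 < p) (hγ : 0 ≤ γ) (hV : 0 < V) (hK : 0 ≤ K)
    (hT : 0 < T) : ∀ (n : ℕ) (x y t : ℕ → ℝ),
    (∀ (m : ℕ) (σ : ℕ → ℕ), StrictMono σ → σ m ≤ n →
      ∑ i ∈ Finset.range m, |x (σ (i + 1)) - x (σ i)| ^ p ≤ V ^ p) →
    (∀ i j, i ≤ j → j ≤ n + 1 → t i ≤ t j) → t (n + 1) - t 0 ≤ T →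
    (∀ i j, i ≤ j → j ≤ n + 1 → |y j - y i| ≤ K * (t j - t i) ^ γ) →
    |∑ i ∈ Finset.range (n + 1), x i * (y (i + 1) - y i) - x 0 * (y (n + 1) - y 0)|
      ≤ K * V * T ^ γ * ∑ k ∈ Finset.range n, (2 / ((k : ℝ) + 1)) ^ (1 / p + γ) := by
  intro n
  induction n with
  | zero => intro x y t _ _ _ _; simp
  | succ n ih =>
    intro x y t hx ht htT hy
    have hVp : 0 < V ^ p := Real.rpow_pos_of_pos hV p
    -- Pigeonhole: the normalised variation of `x` and the normalised lengths each sum to at most 1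
    -- over $n+1$ indices. Deleting the point found here costs a product bounded by
    -- $KVT^\gamma(2/(n+1))^{1/p+\gamma}$.
    obtain ⟨i, hi, hmin⟩ : ∃ i ∈ Finset.range (n + 1),
        |x (i + 1) - x i| ^ p / V ^ p + (t (i + 2) - t (i + 1)) / T ≤ 2 / ((n : ℝ) + 1) := by
      refine Finset.exists_le_of_sum_le ⟨0, by simp⟩ ?_
      have h1 : (∑ i ∈ Finset.range (n + 1), |x (i + 1) - x i| ^ p) / V ^ p ≤ 1 :=
        (div_le_one hVp).2 (hx (n + 1) id strictMono_id le_rfl)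
      have h2 : (∑ i ∈ Finset.range (n + 1), (t (i + 2) - t (i + 1))) / T ≤ 1 := by
        rw [div_le_one hT, Finset.sum_range_sub (fun i => t (i + 1))]
        have := ht 0 (0 + 1) (by omega) (by omega)
        linarith
      have hn : (n : ℝ) + 1 ≠ 0 := by positivity
      rw [Finset.sum_add_distrib, ← Finset.sum_div, ← Finset.sum_div, Finset.sum_const,
        Finset.card_range, nsmul_eq_mul, Nat.cast_add, Nat.cast_one, mul_div_cancel₀ _ hn]
      linarith
    have hin := Finset.mem_range.1 hi
    have hti : 0 ≤ t (i + 2) - t (i + 1) := sub_nonneg.2 (ht _ _ (by omega) (by omega))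
    have hn : (0 : ℝ) < 2 / ((n : ℝ) + 1) := by positivity
    have hxi : |x (i + 1) - x i| ≤ V * (2 / ((n : ℝ) + 1)) ^ (1 / p) := by
      have h1 : |x (i + 1) - x i| ^ p / V ^ p ≤ 2 / ((n : ℝ) + 1) := by
        have : 0 ≤ (t (i + 2) - t (i + 1)) / T := by positivity
        linarith
      have h2 := Real.rpow_le_rpow (by positivity) h1 (show 0 ≤ 1 / p by positivity)
      rw [Real.div_rpow (by positivity) hVp.le, ← Real.rpow_mul (abs_nonneg _),
        ← Real.rpow_mul hV.le, mul_one_div_cancel hp.ne', Real.rpow_one, Real.rpow_one,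
        div_le_iff₀ hV] at h2
      linarith
    have hyi : |y (i + 2) - y (i + 1)| ≤ K * (T ^ γ * (2 / ((n : ℝ) + 1)) ^ γ) := by
      refine (hy _ _ (by omega) (by omega)).trans (mul_le_mul_of_nonneg_left ?_ hK)
      rw [← Real.mul_rpow hT.le hn.le]
      refine Real.rpow_le_rpow hti ?_ hγ
      have : 0 ≤ |x (i + 1) - x i| ^ p / V ^ p := by positivity
      rw [← div_le_iff₀' hT]
      linarith
    have hd := skipSucc_strictMono i
    have d0 : skipSucc i 0 = 0 := by simp [skipSucc]
    have dn : skipSucc i (n + 1) = n + 2 := by simp [skipSucc]; omega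
    have hdn : ∀ j ≤ n + 1, skipSucc i j ≤ n + 2 := fun j hj => dn ▸ hd.monotone hj
    -- The variation bound is assumed along every increasing selection of indices, so it survives
    -- the deletion of a point.
    have IH := ih (fun k => x (skipSucc i k)) (fun k => y (skipSucc i k))
      (fun k => t (skipSucc i k)) ?_ ?_ ?_ ?_
    · simp only [d0, dn] at IH
      have hsum := sum_sub_sum_skipSucc x y i (n - i)
      rw [show i + (n - i) + 2 = n + 1 + 1 by omega, show i + (n - i) + 1 = n + 1 by omega] at hsum
      rw [Finset.sum_range_succ _ n, mul_add]
      have hlast : |(x (i + 1) - x i) * (y (i + 2) - y (i + 1))|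
          ≤ K * V * T ^ γ * (2 / ((n : ℝ) + 1)) ^ (1 / p + γ) := by
        rw [abs_mul, Real.rpow_add hn]
        refine (mul_le_mul hxi hyi (abs_nonneg _) (by positivity)).trans (le_of_eq ?_)
        ring
      refine le_trans (le_of_eq ?_) ((abs_add_le _ _).trans (add_le_add IH hlast))
      rw [← hsum]
      congr 1
      ring
    · intro m σ hσ hm
      refine hx m (fun k => skipSucc i (σ k)) (hd.comp hσ) ?_
      have := hd.monotone hm
      simp only [skipSucc] at this ⊢
      split_ifs at this ⊢ <;> omega
    · exact fun k l hkl hl => ht _ _ (hd.monotone hkl) (hdn l hl)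
    · simp only [d0, dn]
      exact htT
    · exact fun k l hkl hl => hy _ _ (hd.monotone hkl) (hdn l hl)

/-! ### Bounds from the `p`-variation -/

theorem sum_rpow_le_of_pVar_le {T p V : ℝ} (hp : 0 < p) (hV : 0 ≤ V)
    {f : Set.Icc (0 : ℝ) T → ℝ} (hf : pVar p f ≤ ENNReal.ofReal V) (π : Partn T) :
    ∑ i, |π.incr f i| ^ p ≤ V ^ p := by
  have h := (le_iSup (fun π : Partn T =>
    ENNReal.ofReal ((∑ i, |π.incr f i| ^ p) ^ (1 / p))) π).trans hf
  rw [ENNReal.ofReal_le_ofReal_iff hV] at h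
  have h2 := Real.rpow_le_rpow (by positivity) h hp.le
  rwa [← Real.rpow_mul (by positivity), one_div_mul_cancel hp.ne', Real.rpow_one] at h2

/-- The partition of `[0,T]` by the points `u 0 < ⋯ < u m` and the endpoints. -/
def Partn.ofInterior {T : ℝ} (m : ℕ) (u : ℕ → Set.Icc (0 : ℝ) T)
    (hu : ∀ i < m, u i < u (i + 1)) (h0 : 0 < (u 0 : ℝ)) (hm : (u m : ℝ) < T) : Partn T where
  N := m + 2
  pt k := if (k : ℕ) = 0 then ⟨0, le_rfl, (u 0).2.1.trans (u 0).2.2⟩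
    else if (k : ℕ) ≤ m + 1 then u (k - 1) else ⟨T, (u 0).2.1.trans (u 0).2.2, le_rfl⟩
  strictMono := by
    rw [Fin.strictMono_iff_lt_succ]
    rintro ⟨k, hk⟩
    rcases k with _ | k
    · simp only [Fin.val_castSucc, Fin.val_succ]
      simp only [Nat.zero_add, one_ne_zero, if_true, if_false]
      rw [if_pos (by omega)]
      exact h0
    · simp only [Fin.val_castSucc, Fin.val_succ]
      rw [if_neg (by omega), if_pos (by omega), if_neg (by omega)]
      rcases Nat.lt_or_ge k m with h | h
      · rw [if_pos (by omega)]
        exact hu k h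
      · rw [if_neg (by omega)]
        have : k = m := by omega
        subst this
        exact hm
  pt_zero := by simp
  pt_last := by simp

/-- Tags lie strictly inside $(0,T)$ and become a partition once the endpoints are added. The
increment up to $T$ is dropped; the one from $0$ is kept because it controls the size of $f$ when
$f$ vanishes at $0$. -/
theorem sum_range_rpow_le_of_pVar_le {T p V : ℝ} (hp : 0 < p) (hV : 0 ≤ V)
    {f : Set.Icc (0 : ℝ) T → ℝ} (hf : pVar p f ≤ ENNReal.ofReal V) (m : ℕ)
    (u : ℕ → Set.Icc (0 : ℝ) T) (hu : ∀ i < m, u i < u (i + 1)) (h0 : 0 < (u 0 : ℝ))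
    (hm : (u m : ℝ) < T) :
    |f (u 0) - f ⟨0, le_rfl, (u 0).2.1.trans (u 0).2.2⟩| ^ p
      + ∑ i ∈ Finset.range m, |f (u (i + 1)) - f (u i)| ^ p ≤ V ^ p := by
  refine le_trans ?_ (sum_rpow_le_of_pVar_le hp hV hf (Partn.ofInterior m u hu h0 hm))
  change _ ≤ ∑ i : Fin (m + 2), _
  rw [Fin.sum_univ_succ, Fin.sum_univ_castSucc, Finset.sum_range, ← add_assoc]
  refine le_trans (le_of_eq ?_) (le_add_of_nonneg_right (by positivity))
  congr 1
  refine Finset.sum_congr rfl fun i _ => ?_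
  have := i.2
  simp only [Partn.incr, Partn.ofInterior, Fin.val_castSucc, Fin.val_succ]
  rw [if_neg (by omega), if_pos (by omega), if_neg (by omega), if_pos (by omega)]
  simp

theorem abs_le_of_pVar_le {T p V : ℝ} (hp : 0 < p) (hV : 0 ≤ V) {f : Set.Icc (0 : ℝ) T → ℝ}
    (hf : pVar p f ≤ ENNReal.ofReal V) (hf0 : ∀ s : Set.Icc (0 : ℝ) T, (s : ℝ) = 0 → f s = 0)
    (c : Set.Icc (0 : ℝ) T) (h0 : 0 < (c : ℝ)) (hT : (c : ℝ) < T) : |f c| ≤ V := by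
  have h := sum_range_rpow_le_of_pVar_le hp hV hf 0 (fun _ => c) (by simp) h0 hT
  rw [hf0 ⟨0, le_rfl, c.2.1.trans c.2.2⟩ rfl, sub_zero, Finset.sum_range_zero, add_zero] at h
  exact (Real.rpow_le_rpow_iff (abs_nonneg _) hV hp).1 h

namespace TaggedPartn

variable {T : ℝ} (π : TaggedPartn T)

theorem tag_pos (i : Fin π.N) : 0 < (π.tag i : ℝ) :=
  (π.pt i.castSucc).2.1.trans_lt (π.tag_mem i).1

theorem tag_lt (i : Fin π.N) : (π.tag i : ℝ) < T :=
  lt_of_lt_of_le (π.tag_mem i).2 (π.pt i.succ).2.2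

theorem tag_strictMono : StrictMono π.tag := by
  intro i j hij
  refine (π.tag_mem i).2.trans_le (le_trans ?_ (π.tag_mem j).1.le)
  exact π.strictMono.monotone (Fin.succ_le_castSucc_iff.2 hij)

/-- The Love–Young inequality along a tagged partition, for a Hölder continuous integrator. -/
theorem abs_sum_mul_incr_le {p γ V K : ℝ} (hp : 0 < p) (hγ : 0 ≤ γ) (hV : 0 < V) (hK : 0 ≤ K)
    (hT : 0 < T) (hθ : 1 < 1 / p + γ) {f g : Set.Icc (0 : ℝ) T → ℝ}
    (hf : pVar p f ≤ ENNReal.ofReal V) (hf0 : ∀ s : Set.Icc (0 : ℝ) T, (s : ℝ) = 0 → f s = 0)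
    (hg : ∀ a b : Set.Icc (0 : ℝ) T, a ≤ b → |g b - g a| ≤ K * ((b : ℝ) - a) ^ γ) :
    |∑ i, f (π.tag i) * π.incr g i|
      ≤ K * V * T ^ γ * (1 + ∑' k : ℕ, (2 / ((k : ℝ) + 1)) ^ (1 / p + γ)) := by
  obtain ⟨n, hn⟩ : ∃ n, π.N = n + 1 := by
    refine Nat.exists_eq_succ_of_ne_zero fun h => ?_
    have h1 := π.pt_last
    have h2 : Fin.last π.N = 0 := Fin.ext h
    rw [h2, π.pt_zero] at h1
    exact hT.ne h1
  -- Tags and division points are indexed by all of ℕ by clamping at the last index; the values past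
  -- the end do not enter the sums.
  let c : ℕ → Set.Icc (0 : ℝ) T := fun i => π.tag ⟨min i n, by omega⟩
  let u : ℕ → Set.Icc (0 : ℝ) T := fun i => π.pt ⟨min i (n + 1), by omega⟩
  have humono : Monotone u := fun i j hij => π.strictMono.monotone
    (Fin.mk_le_mk.2 (min_le_min hij le_rfl))
  have hu0 : (u 0 : ℝ) = 0 := π.pt_zero
  have huT : (u (n + 1) : ℝ) = T := by
    refine Eq.trans ?_ π.pt_last
    simp only [u]
    congr 2
    exact Fin.ext (by simp [hn])
  have hsum : ∑ i, f (π.tag i) * π.incr g i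
      = ∑ i ∈ Finset.range (n + 1), f (c i) * (g (u (i + 1)) - g (u i)) := by
    rw [Finset.sum_range]
    refine Fintype.sum_equiv (finCongr hn) _ _ fun i => ?_
    have := i.2
    simp only [Partn.incr, c, u, finCongr_apply, Fin.val_cast]
    congr 3
    · exact Fin.ext (by simp; omega)
    · congr 2
      exact Fin.ext (by simp; omega)
    · congr 2
      exact Fin.ext (by simp; omega)
  have hy := abs_sum_sub_le_of_pVar hp hγ hV hK hT n (fun i => f (c i)) (fun i => g (u i))
    (fun i => (u i : ℝ)) ?_ (fun i j hij _ => humono hij) (by rw [hu0, huT, sub_zero])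
    (fun i j hij _ => hg _ _ (humono hij))
  · have hsummable : Summable fun k : ℕ => (2 / ((k : ℝ) + 1)) ^ (1 / p + γ) := by
      have h1 := (summable_nat_add_iff 1).2 (Real.summable_nat_rpow_inv.2 hθ)
      refine (h1.mul_left (2 ^ (1 / p + γ))).congr fun k => ?_
      rw [Real.div_rpow (by norm_num) (by positivity)]
      push_cast
      rfl
    have hle : ∑ k ∈ Finset.range n, (2 / ((k : ℝ) + 1)) ^ (1 / p + γ)
        ≤ ∑' k : ℕ, (2 / ((k : ℝ) + 1)) ^ (1 / p + γ) :=
      hsummable.sum_le_tsum _ fun k _ => by positivity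
    -- The comparison term of the discrete inequality accounts for the `1 +` in the constant.
    have hfirst : |f (c 0) * (g (u (n + 1)) - g (u 0))| ≤ V * (K * T ^ γ) := by
      rw [abs_mul]
      refine mul_le_mul (abs_le_of_pVar_le hp hV.le hf hf0 _ (π.tag_pos _) (π.tag_lt _)) ?_
        (abs_nonneg _) hV.le
      have := hg _ _ (humono (Nat.zero_le (n + 1)))
      rwa [hu0, huT, sub_zero] at this
    rw [hsum]
    have h2 := mul_le_mul_of_nonneg_left hle (show 0 ≤ K * V * T ^ γ by positivity)
    have h3 := abs_add_le
      (∑ i ∈ Finset.range (n + 1), f (c i) * (g (u (i + 1)) - g (u i))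
        - f (c 0) * (g (u (n + 1)) - g (u 0))) (f (c 0) * (g (u (n + 1)) - g (u 0)))
    rw [sub_add_cancel] at h3
    linarith
  · intro m σ hσ hm
    have h := sum_range_rpow_le_of_pVar_le hp hV.le hf m (fun i => c (σ i)) (fun i hi => ?_)
      (π.tag_pos _) (π.tag_lt _)
    · refine le_trans (le_add_of_nonneg_left (by positivity)) h
    · refine π.tag_strictMono (Fin.mk_lt_mk.2 ?_)
      have h1 := hσ (Nat.lt_succ_self i)
      have h2 := hσ.monotone (Nat.succ_le_of_lt hi)
      simp only [Nat.succ_eq_add_one] at h1 h2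
      omega

end TaggedPartn

/-! ### Riemann sums of smooth integrands -/

/-- With `X` frozen at `X u` on $[u,c]$ and at `X v` on $[c,v]$, the integral of $F'X$ becomes
$(F(c)-F(u))X(u)+(F(v)-F(c))X(v)$, and the boundary terms minus this are exactly $F(c)(X(v)-X(u))$.
The error comes only from the oscillation of `X`. -/
theorem norm_smul_sub_integral_le {E : Type*} [NormedAddCommGroup E] [NormedSpace ℝ E]
    [CompleteSpace E] {F F' : ℝ → ℝ} {X : ℝ → E} {u c v L ε : ℝ} (huc : u ≤ c) (hcv : c ≤ v)
    (hF : ∀ s ∈ Set.Icc u v, HasDerivWithinAt F (F' s) (Set.Icc u v) s)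
    (hF' : ContinuousOn F' (Set.Icc u v)) (hX : ContinuousOn X (Set.Icc u v))
    (hL : ∀ s ∈ Set.Icc u v, |F' s| ≤ L)
    (hε : ∀ s ∈ Set.Icc u v, ∀ t ∈ Set.Icc u v, ‖X s - X t‖ ≤ ε) :
    ‖F c • (X v - X u) - (F v • X v - F u • X u - ∫ s in u..v, F' s • X s)‖
      ≤ L * ε * (v - u) := by
  have huv := huc.trans hcv
  have sub1 : Set.Icc u c ⊆ Set.Icc u v := Set.Icc_subset_Icc le_rfl hcv
  have sub2 : Set.Icc c v ⊆ Set.Icc u v := Set.Icc_subset_Icc huc le_rfl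
  have piece : ∀ (a b : ℝ), a ≤ b → Set.Icc a b ⊆ Set.Icc u v → ∀ w ∈ Set.Icc u v,
      IntervalIntegrable (fun s => F' s • X s) volume a b ∧
      ‖(∫ s in a..b, F' s • X s) - (F b - F a) • X w‖ ≤ L * ε * (b - a) := by
    intro a b hab hsub w hw
    have hF'i : IntervalIntegrable F' volume a b :=
      (hF'.mono hsub).intervalIntegrable_of_Icc hab
    have hi : IntervalIntegrable (fun s => F' s • X s) volume a b :=
      ((hF'.smul hX).mono hsub).intervalIntegrable_of_Icc hab
    have hiw : IntervalIntegrable (fun s => F' s • X w) volume a b :=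
      ((hF'.smul continuousOn_const).mono hsub).intervalIntegrable_of_Icc hab
    refine ⟨hi, ?_⟩
    have hFTC : ∫ s in a..b, F' s = F b - F a := by
      refine intervalIntegral.integral_eq_sub_of_hasDerivAt_of_le hab ?_ ?_ hF'i
      · exact fun s hs => ((hF s (hsub hs)).mono hsub).continuousWithinAt
      · exact fun s hs => ((hF s (hsub (Set.Ioo_subset_Icc_self hs))).mono hsub).hasDerivAt
          (Icc_mem_nhds hs.1 hs.2)
    rw [← hFTC, ← intervalIntegral.integral_smul_const, ← intervalIntegral.integral_sub hi
      hiw]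
    refine (intervalIntegral.norm_integral_le_of_norm_le_const (C := L * ε) fun s hs => ?_).trans
      (by rw [abs_of_nonneg (sub_nonneg.2 hab)])
    rw [Set.uIoc_of_le hab] at hs
    have hs' := hsub (Set.Ioc_subset_Icc_self hs)
    rw [← smul_sub, norm_smul]
    exact mul_le_mul (hL s hs') (hε s hs' w hw) (norm_nonneg _) ((abs_nonneg _).trans (hL s hs'))
  obtain ⟨i1, h1⟩ := piece u c huc sub1 u ⟨le_rfl, huv⟩
  obtain ⟨i2, h2⟩ := piece c v hcv sub2 v ⟨huv, le_rfl⟩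
  rw [← intervalIntegral.integral_add_adjacent_intervals i1 i2]
  calc _ = ‖((∫ s in u..c, F' s • X s) - (F c - F u) • X u)
        + ((∫ s in c..v, F' s • X s) - (F v - F c) • X v)‖ := by
        congr 1
        simp only [sub_smul, smul_sub]
        abel
    _ ≤ _ := (norm_add_le _ _).trans (by linarith)

/-- Integration by parts for `∫ F dX` with `F` of class `C¹` and `X` a Hölder continuous path in a
Banach space. -/
theorem exists_tendsto_sum_smul_incr {E : Type*} [NormedAddCommGroup E] [NormedSpace ℝ E]
    [CompleteSpace E] {T H : ℝ} (hT : 0 < T) (hH : 0 < H) {F : ℝ → ℝ}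
    (hF : ContDiffOn ℝ 1 F (Set.Icc 0 T)) {X : Set.Icc (0 : ℝ) T → E}
    (hX : ∀ s t, ‖X t - X s‖ ≤ |(t : ℝ) - s| ^ H) :
    ∃ I : E, Tendsto (fun π : TaggedPartn T => ∑ i, F (π.tag i) • π.incr X i)
      (comap (fun π => π.mesh) (𝓝 0)) (𝓝 I) := by
  have hu := uniqueDiffOn_Icc hT
  set F' := derivWithin F (Set.Icc 0 T) with hF'
  have hd : ∀ s ∈ Set.Icc 0 T, HasDerivWithinAt F (F' s) (Set.Icc 0 T) s := fun s hs =>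
    (hF.differentiableOn one_ne_zero s hs).hasDerivWithinAt
  have hc : ContinuousOn F' (Set.Icc 0 T) := hF.continuousOn_derivWithin hu le_rfl
  obtain ⟨L, hL⟩ := isCompact_Icc.exists_bound_of_continuousOn hc
  have hXc : Continuous X := by
    refine continuous_iff_continuousAt.2 fun s => tendsto_iff_norm_sub_tendsto_zero.2 ?_
    have hlim : Tendsto (fun t : Set.Icc (0 : ℝ) T => |(t : ℝ) - s| ^ H) (𝓝 s) (𝓝 0) := by
      have hcont : Continuous fun t : Set.Icc (0 : ℝ) T => |(t : ℝ) - s| ^ H :=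
        (continuous_subtype_val.sub continuous_const).abs.rpow_const fun _ => Or.inr hH.le
      have := hcont.tendsto s
      rwa [sub_self, abs_zero, Real.zero_rpow hH.ne'] at this
    exact squeeze_zero (fun _ => norm_nonneg _) (fun t => hX s t) hlim
  let Y : ℝ → E := Set.IccExtend hT.le X
  have hYc : Continuous Y := hXc.Icc_extend'
  have hY : ∀ s : Set.Icc (0 : ℝ) T, Y s = X s := fun s => Set.IccExtend_val _ _ _
  -- Increments of `Z` telescope along every partition, so the limit is $Z(T)-Z(0)$ and only the
  -- local errors, in total at most `L * π.mesh ^ H * T`, remain.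
  let Z : Set.Icc (0 : ℝ) T → E := fun t => F t • X t - ∫ s in (0 : ℝ)..t, F' s • Y s
  have hint : ∀ a b : Set.Icc (0 : ℝ) T,
      IntervalIntegrable (fun s => F' s • Y s) volume (a : ℝ) b := fun a b =>
    ((hc.smul hYc.continuousOn).mono (Set.uIcc_subset_Icc a.2 b.2)).intervalIntegrable
  refine ⟨Z ⟨T, hT.le, le_rfl⟩ - Z ⟨0, le_rfl, hT.le⟩, ?_⟩
  have hbound : ∀ π : TaggedPartn T,
      ‖(∑ i, F (π.tag i) • π.incr X i) - (Z ⟨T, hT.le, le_rfl⟩ - Z ⟨0, le_rfl, hT.le⟩)‖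
        ≤ L * π.mesh ^ H * T := by
    intro π
    rw [← π.sum_incr Z, ← Finset.sum_sub_distrib]
    refine (norm_sum_le _ _).trans ?_
    refine le_trans ?_ (congrArg _ π.sum_length).le
    rw [Finset.mul_sum]
    refine Finset.sum_le_sum fun i _ => ?_
    have hsub : Set.Icc (π.pt i.castSucc : ℝ) (π.pt i.succ) ⊆ Set.Icc 0 T :=
      Set.Icc_subset_Icc (π.pt i.castSucc).2.1 (π.pt i.succ).2.2
    have h := norm_smul_sub_integral_le (F := F) (F' := F') (X := Y) (L := L)
      (ε := π.mesh ^ H) (π.tag_mem i).1.le (π.tag_mem i).2.le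
      (fun s hs => (hd s (hsub hs)).mono hsub) (hc.mono hsub) hYc.continuousOn
      (fun s hs => hL s (hsub hs)) ?_
    · rw [hY, hY] at h
      refine le_trans (le_of_eq ?_) h
      congr 2
      simp only [Partn.incr, Z]
      rw [← intervalIntegral.integral_interval_sub_left (hint ⟨0, le_rfl, hT.le⟩ _)
        (hint ⟨0, le_rfl, hT.le⟩ _)]
      abel
    · intro s hs t ht
      have e1 : Y s = X ⟨s, hsub hs⟩ := hY ⟨s, hsub hs⟩
      have e2 : Y t = X ⟨t, hsub ht⟩ := hY ⟨t, hsub ht⟩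
      rw [e1, e2]
      refine (hX _ _).trans (Real.rpow_le_rpow (abs_nonneg _) ?_ hH.le)
      exact (Set.abs_sub_le_of_uIcc_subset_uIcc (Set.uIcc_subset_uIcc
        (Set.Icc_subset_uIcc ht) (Set.Icc_subset_uIcc hs))).trans
        ((abs_of_nonneg (sub_nonneg.2 (π.castSucc_le_succ i))).le.trans (π.length_le_mesh i))
  refine tendsto_iff_norm_sub_tendsto_zero.2 (squeeze_zero (fun _ => norm_nonneg _)
    hbound ?_)
  have h0 : Tendsto (fun π : TaggedPartn T => π.mesh ^ H) (comap (fun π => π.mesh) (𝓝 0))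
      (𝓝 (0 ^ H)) := tendsto_comap.rpow_const (Or.inr hH.le)
  rw [Real.zero_rpow hH.ne'] at h0
  simpa using (h0.const_mul L).mul_const T

/-! ### Hilbert space structure of the Cameron-Martin space -/

namespace CameronMartin

variable {E : Type*} [NormedAddCommGroup E] [NormedSpace ℝ E] [CompleteSpace E]
  [SecondCountableTopology E] [MeasurableSpace E] [BorelSpace E] (μ : Measure E) [IsGaussian μ]

/-- `preJ` as an isometry. -/
noncomputable def preJIsometry : CameronMartin μ ≃ₗᵢ[ℝ] ↥(dualClosure μ) := ⟨preJ μ, fun _ => rfl⟩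

instance : CompleteSpace (CameronMartin μ) := by
  have : CompleteSpace ↥(dualClosure μ) :=
    (Submodule.isClosed_topologicalClosure _).completeSpace_coe
  exact (preJIsometry μ).toIsometryEquiv.completeSpace

end CameronMartin

section FBM

variable {H : ℝ} (hH : 0 < H) {T : ℝ} {P : Measure (WienerSpace T)} [IsGaussian P]
  (hP : IsFBMLaw H P)

theorem preJ_covElem (t : Set.Icc (0 : ℝ) T) :
    (CameronMartin.preJ P (covElem hH hP t) : Lp ℝ 2 P) = StrongDual.toLp P 2 (evalW t) := by
  have hm : StrongDual.toLp P 2 (evalW t) ∈ dualClosure P :=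
    Submodule.le_topologicalClosure _ ⟨evalW t, rfl⟩
  have h : CameronMartin.preJ P (covElem hH hP t) = ⟨_, hm⟩ := by
    refine gaussJ_injOn P ?_
    exact (CameronMartin.gaussJ_preJ P (covElem hH hP t)).trans (gaussJ_eval hH hP t).symm
  rw [h]

/-- The reproducing property of the Cameron-Martin space. -/
theorem inner_covElem (t : Set.Icc (0 : ℝ) T) (h : CameronMartin P) :
    inner ℝ (covElem hH hP t) h = CameronMartin.incl P h t := by
  rw [CameronMartin.inner_eq, preJ_covElem, ← dual_gaussJ, CameronMartin.gaussJ_preJ]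
  rfl

theorem incl_covElem (t s : Set.Icc (0 : ℝ) T) :
    CameronMartin.incl P (covElem hH hP t) s = fbmCov H t s := rfl

/-- By the reproducing property this is $R(t,t)-2R(s,t)+R(s,s)$. It makes $t\mapsto R(t,\cdot)$ an
$H$-Hölder path in $\mathcal H$, as the integration by parts requires. -/
theorem norm_covElem_sub_sq (s t : Set.Icc (0 : ℝ) T) :
    ‖covElem hH hP t - covElem hH hP s‖ ^ 2 = |(t : ℝ) - s| ^ (2 * H) := by
  rw [← real_inner_self_eq_norm_sq, inner_sub_left, inner_sub_right, inner_sub_right]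
  simp only [inner_covElem, incl_covElem, fbmCov]
  have hz : (0 : ℝ) ^ (2 * H) = 0 := Real.zero_rpow (by linarith)
  rw [sub_self, sub_self, abs_zero, hz, abs_sub_comm (s : ℝ) t]
  ring

theorem norm_covElem_sub (s t : Set.Icc (0 : ℝ) T) :
    ‖covElem hH hP t - covElem hH hP s‖ = |(t : ℝ) - s| ^ H := by
  rw [← sq_eq_sq₀ (norm_nonneg _) (by positivity), norm_covElem_sub_sq, mul_comm,
    Real.rpow_mul (abs_nonneg _), Real.rpow_two]

theorem inner_incr_covElem (π : Partn T) (i : Fin π.N) (h : CameronMartin P) :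
    inner ℝ (π.incr (covElem hH hP) i) h = π.incr (CameronMartin.incl P h) i := by
  simp only [Partn.incr, inner_sub_left, inner_covElem]

theorem inner_riemannSum (α : WienerSpace T) (π : TaggedPartn T) (h : CameronMartin P) :
    inner ℝ (riemannSum hH hP α π) h
      = ∑ i, α (π.tag i) * π.incr (CameronMartin.incl P h) i := by
  simp only [riemannSum, sum_inner, real_inner_smul_left, inner_incr_covElem]

/-- The two partitions are unrelated, so norm convergence of the sums yields the two-dimensional
Young integral directly. -/
theorem inner_riemannSum_riemannSum (α : WienerSpace T) (π ψ : TaggedPartn T) :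
    inner ℝ (riemannSum hH hP α π) (riemannSum hH hP α ψ)
      = ∑ i, ∑ j, (α (π.tag i) * α (ψ.tag j)) *
        rectIncr π.toPartn ψ.toPartn (fun s t => fbmCov H s t) i j := by
  rw [inner_riemannSum]
  refine Finset.sum_congr rfl fun i _ => ?_
  rw [← inner_incr_covElem hH hP, real_inner_comm, inner_riemannSum, Finset.mul_sum]
  refine Finset.sum_congr rfl fun j _ => ?_
  simp only [Partn.incr, map_sub, rectIncr]
  change _ * (_ * ((fbmCov H _ _ - fbmCov H _ _) - (fbmCov H _ _ - fbmCov H _ _))) = _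
  ring

theorem riemannSum_sub (α β : WienerSpace T) (π : TaggedPartn T) :
    riemannSum hH hP (α - β) π = riemannSum hH hP α π - riemannSum hH hP β π := by
  simp only [riemannSum, ← Finset.sum_sub_distrib]
  exact Finset.sum_congr rfl fun i _ => sub_smul _ _ _

/-- The path of a Riemann sum is Hölder continuous of exponent `2H`. -/
theorem abs_incl_riemannSum_sub_le (hH' : H ≤ 1 / 2) {p V : ℝ} (hp : 0 < p) (hV : 0 ≤ V)
    {α : WienerSpace T} (hα : pVar p α ≤ ENNReal.ofReal V) (π : TaggedPartn T)
    {a b : Set.Icc (0 : ℝ) T} (hab : a ≤ b) :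
    |CameronMartin.incl P (riemannSum hH hP α π) b - CameronMartin.incl P (riemannSum hH hP α π) a|
      ≤ 2 * V * ((b : ℝ) - a) ^ (2 * H) := by
  -- Evaluation is pairing with $R(b,\cdot)$ and $R(a,\cdot)$: the increment is a sum of rectangular
  -- increments of $R$ over the strip $[a,b]$, weighted by values of `α` bounded by `V`.
  have h : CameronMartin.incl P (riemannSum hH hP α π) b
      - CameronMartin.incl P (riemannSum hH hP α π) a
      = ∑ j : Fin π.N, α (π.tag j) * (fbmCov H b (π.pt j.succ) - fbmCov H b (π.pt j.castSucc)
        - fbmCov H a (π.pt j.succ) + fbmCov H a (π.pt j.castSucc)) := by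
    rw [← inner_covElem hH hP, ← inner_covElem hH hP, real_inner_comm, inner_riemannSum,
      real_inner_comm, inner_riemannSum, ← Finset.sum_sub_distrib]
    refine Finset.sum_congr rfl fun j _ => ?_
    simp only [Partn.incr, incl_covElem]
    ring
  rw [h]
  refine (Finset.abs_sum_le_sum_abs _ _).trans ?_
  refine (Finset.sum_le_sum fun j _ => ?_).trans
    ((Finset.mul_sum _ _ V).symm.le.trans ((mul_le_mul_of_nonneg_left
      (sum_abs_fbmCov_le hH hH' π.toPartn hab) hV).trans (le_of_eq (by ring))))
  rw [abs_mul]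
  exact mul_le_mul_of_nonneg_right
    (abs_le_of_pVar_le hp hV hα α.2 _ (π.tag_pos j) (π.tag_lt j)) (abs_nonneg _)

/-- Pairing the Riemann sum with itself integrates `α` against the path of that sum, which is
$2H$-Hölder with constant $2V$; the Love–Young inequality then applies. The bound does not involve
the partition. -/
theorem norm_riemannSum_sq_le (hH' : H ≤ 1 / 2) {p V : ℝ} (hp : 0 < p) (hV : 0 < V) (hT : 0 < T)
    (hθ : 1 < 1 / p + 2 * H) {α : WienerSpace T} (hα : pVar p α ≤ ENNReal.ofReal V)
    (π : TaggedPartn T) :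
    ‖riemannSum hH hP α π‖ ^ 2 ≤
      2 * (1 + ∑' k : ℕ, (2 / ((k : ℝ) + 1)) ^ (1 / p + 2 * H)) * V ^ 2 * T ^ (2 * H) := by
  rw [← real_inner_self_eq_norm_sq, inner_riemannSum]
  refine (le_abs_self _).trans ((π.abs_sum_mul_incr_le (K := 2 * V) hp (by linarith) hV
    (by positivity) hT hθ hα α.2 fun a b hab =>
      abs_incl_riemannSum_sub_le hH hP hH' hp hV.le hα π hab).trans (le_of_eq (by ring)))

end FBM

/-! ### Convergence of the Riemann sums -/

/-- The partition of `[0,T]` into `n + 1` equal intervals, tagged with their midpoints. -/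
noncomputable def TaggedPartn.uniform {T : ℝ} (hT : 0 < T) (n : ℕ) : TaggedPartn T where
  N := n + 1
  pt k := ⟨T * ((k : ℕ) / ((n : ℝ) + 1)), by positivity, by
    have h : ((k : ℕ) : ℝ) ≤ (n : ℝ) + 1 := by exact_mod_cast Nat.lt_succ_iff.1 k.2
    exact mul_le_of_le_one_right hT.le ((div_le_one (by positivity)).2 h)⟩
  strictMono := by
    intro k l hkl
    have h : ((k : ℕ) : ℝ) < (l : ℕ) := by exact_mod_cast hkl
    refine Subtype.mk_lt_mk.2 (mul_lt_mul_of_pos_left ?_ hT)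
    exact div_lt_div_of_pos_right h (by positivity)
  pt_zero := by simp
  pt_last := by
    have h : (n : ℝ) + 1 ≠ 0 := by positivity
    simp [div_self h]
  tag k := ⟨T * (((k : ℕ) + 1 / 2) / ((n : ℝ) + 1)), by positivity, by
    have h : ((k : ℕ) : ℝ) + 1 ≤ (n : ℝ) + 1 := by exact_mod_cast k.2
    exact mul_le_of_le_one_right hT.le ((div_le_one (by positivity)).2 (by linarith))⟩
  tag_mem := by
    intro k
    constructor
    · refine Subtype.mk_lt_mk.2 (mul_lt_mul_of_pos_left ?_ hT)
      refine div_lt_div_of_pos_right ?_ (by positivity)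
      simp
    · refine Subtype.mk_lt_mk.2 (mul_lt_mul_of_pos_left ?_ hT)
      refine div_lt_div_of_pos_right ?_ (by positivity)
      simp only [Fin.val_succ]
      push_cast
      linarith

theorem TaggedPartn.tendsto_mesh_uniform {T : ℝ} (hT : 0 < T) :
    Tendsto (fun n => (TaggedPartn.uniform hT n).mesh) atTop (𝓝 0) := by
  have h : Tendsto (fun n : ℕ => T * (1 / ((n : ℝ) + 1))) atTop (𝓝 0) := by
    simpa using (tendsto_one_div_add_atTop_nhds_zero_nat (𝕜 := ℝ)).const_mul T
  refine squeeze_zero (fun n => (TaggedPartn.uniform hT n).mesh_nonneg) (fun n => ?_) h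
  refine Real.iSup_le (fun i => le_of_eq ?_) (by positivity)
  change T * (((i : ℕ) + 1 : ℕ) / ((n : ℝ) + 1)) - T * ((i : ℕ) / ((n : ℝ) + 1)) = _
  push_cast
  ring

theorem TaggedPartn.neBot_comap_mesh {T : ℝ} (hT : 0 < T) :
    (comap (fun π : TaggedPartn T => π.mesh) (𝓝 0)).NeBot :=
  (tendsto_comap_iff (g := fun π : TaggedPartn T => π.mesh)
    (f := TaggedPartn.uniform hT).2
    (TaggedPartn.tendsto_mesh_uniform hT)).neBot

section FBM

variable {H : ℝ} (hH : 0 < H) {T : ℝ} {P : Measure (WienerSpace T)} [IsGaussian P]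
  (hP : IsFBMLaw H P)

/-- Convergence of the Riemann sums in the Cameron-Martin space, by approximation with smooth
integrands. -/
theorem exists_tendsto_riemannSum (hH' : H ≤ 1 / 2) {p : ℝ} (hp : 0 < p) (hT : 0 < T)
    (hθ : 1 < 1 / p + 2 * H) {α : WienerSpace T} (hα : α ∈ Wp T p) :
    ∃ I : CameronMartin P,
      Tendsto (riemannSum hH hP α) (comap (fun π => π.mesh) (𝓝 0)) (𝓝 I) := by
  have := TaggedPartn.neBot_comap_mesh hT
  suffices h : Cauchy (map (riemannSum hH hP α) (comap (fun π => π.mesh) (𝓝 0))) from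
    cauchy_iff_exists_le_nhds.1 h
  refine Metric.cauchy_iff.2 ⟨inferInstance, fun ε hε => ?_⟩
  set D := 2 * (1 + ∑' k : ℕ, (2 / ((k : ℝ) + 1)) ^ (1 / p + 2 * H)) * T ^ (2 * H) with hD
  have hD0 : 0 ≤ D := by
    have : 0 ≤ ∑' k : ℕ, (2 / ((k : ℝ) + 1)) ^ (1 / p + 2 * H) :=
      tsum_nonneg fun k => by positivity
    positivity
  -- Chosen so that `√D * V ≤ ε / 4`; the `+ 1` keeps the denominator visibly positive.
  set V := ε / (4 * (√D + 1)) with hV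
  have hV0 : 0 < V := by positivity
  have hDV : √D * V ≤ ε / 4 := by
    rw [hV, ← mul_div_assoc, div_le_div_iff₀ (by positivity) (by positivity)]
    have := Real.sqrt_nonneg D
    nlinarith
  obtain ⟨f, ⟨F, hF, hfF⟩, hf⟩ := hα.2 (ENNReal.ofReal V) (by simpa using hV0)
  have hclose : ∀ π, ‖riemannSum hH hP α π - riemannSum hH hP f π‖ ≤ ε / 4 := by
    intro π
    have h := norm_riemannSum_sq_le hH hP hH' hp hV0 hT hθ (α := α - f) hf.le π
    rw [riemannSum_sub] at h
    refine le_trans (abs_le_of_sq_le_sq' (b := √D * V) ?_ (by positivity)).2 hDV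
    rw [mul_pow, Real.sq_sqrt hD0]
    linarith
  obtain ⟨I, hI⟩ := exists_tendsto_sum_smul_incr hT hH (hF.of_le (by simp))
    (X := covElem hH hP) fun s t => (norm_covElem_sub hH hP s t).le
  have hI' : Tendsto (riemannSum hH hP f) (comap (fun π => π.mesh) (𝓝 0)) (𝓝 I) := by
    refine hI.congr fun π => ?_
    simp only [riemannSum, hfF]
  refine ⟨_, image_mem_map (hI' (Metric.ball_mem_nhds I (ε := ε / 4) (by positivity))), ?_⟩
  rintro _ ⟨π, hπ, rfl⟩ _ ⟨ψ, hψ, rfl⟩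
  have h1 := hclose π
  have h2 := hclose ψ
  rw [← dist_eq_norm] at h1 h2
  have h3 : dist (riemannSum hH hP f π) I < ε / 4 := hπ
  have h4 : dist (riemannSum hH hP f ψ) I < ε / 4 := hψ
  have t1 := dist_triangle4 (riemannSum hH hP α π) (riemannSum hH hP f π)
    (riemannSum hH hP f ψ) (riemannSum hH hP α ψ)
  have t2 := dist_triangle_right (riemannSum hH hP f π) (riemannSum hH hP f ψ) I
  rw [dist_comm (riemannSum hH hP f ψ)] at t1
  linarith

end FBM

theorem proposition3p3 (H p : ℝ) (hH₁ : 1 / 3 < H) (hH₂ : H < 1 / 2)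
    (hp : p ∈ Set.Ioo (1 / H) (1 / (1 - 2 * H))) :
    ∃ C : ℝ, 0 < C ∧
      ∀ (T : ℝ), 0 < T →
      ∀ (P : Measure (WienerSpace T)) [IsGaussian P] (hP : IsFBMLaw H P),
      ∀ α ∈ Wp T p,
      ∃ I : CameronMartin P,
        (∀ π : ℕ → TaggedPartn T, Tendsto (fun k => (π k).mesh) atTop (𝓝 0) →
          Tendsto (fun k => riemannSum (by linarith : 0 < H) hP α (π k)) atTop (𝓝 I)) ∧
        IsYoungIntegral2D (fun s t => α s * α t) (fun s t => fbmCov H s t) (‖I‖ ^ 2) ∧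
        (pVar2D (T := T) (1 / (2 * H)) (fun s t => fbmCov H s t) ≠ ⊤ ∧
          ‖I‖ ^ 2 ≤ C * (pVar p α).toReal ^ 2 *
            (pVar2D (T := T) (1 / (2 * H)) (fun s t => fbmCov H s t)).toReal) ∧
        (∀ h : CameronMartin P,
          IsYoungIntegral α (CameronMartin.incl P h) (inner ℝ I h)) ∧
        (∀ s : Set.Icc (0 : ℝ) T,
          IsYoungIntegral α (fun t => fbmCov H t s) (CameronMartin.incl P I s)) := by
  have hH : 0 < H := by linarith
  have hp0 : 0 < p := lt_trans (by positivity) hp.1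
  -- The upper bound on $p$ is exactly the Young condition.
  have hθ : 1 < 1 / p + 2 * H := by
    have h := one_div_lt_one_div_of_lt hp0 hp.2
    rw [one_div_one_div] at h
    linarith
  have htsum : 0 ≤ ∑' k : ℕ, (2 / ((k : ℝ) + 1)) ^ (1 / p + 2 * H) :=
    tsum_nonneg fun k => by positivity
  set C := 2 * (1 + ∑' k : ℕ, (2 / ((k : ℝ) + 1)) ^ (1 / p + 2 * H)) with hC
  have hC0 : 0 < C := by positivity
  refine ⟨C, hC0, fun T hT P _ hP α hα => ?_⟩
  have := TaggedPartn.neBot_comap_mesh hT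
  obtain ⟨I, hI⟩ := exists_tendsto_riemannSum hH hP hH₂.le hp0 hT hθ hα
  have hseq : ∀ π : ℕ → TaggedPartn T, Tendsto (fun k => (π k).mesh) atTop (𝓝 0) →
      Tendsto (fun k => riemannSum hH hP α (π k)) atTop (𝓝 I) := fun π hπ =>
    hI.comp (tendsto_comap_iff.2 hπ)
  have hinner : ∀ h : CameronMartin P,
      IsYoungIntegral α (CameronMartin.incl P h) (inner ℝ I h) := fun h π hπ =>
    ((hseq π hπ).inner tendsto_const_nhds).congr fun k => inner_riemannSum hH hP α (π k) h
  refine ⟨I, hseq, ?_, ⟨pVar2D_fbmCov_ne_top hH hH₂.le T, ?_⟩, hinner, ?_⟩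
  · intro π ψ h
    rw [← real_inner_self_eq_norm_sq]
    have hπ : Tendsto (fun k => (π k).mesh) atTop (𝓝 0) :=
      squeeze_zero (fun k => (π k).mesh_nonneg) (fun k => le_max_left _ _) h
    have hψ : Tendsto (fun k => (ψ k).mesh) atTop (𝓝 0) :=
      squeeze_zero (fun k => (ψ k).mesh_nonneg) (fun k => le_max_right _ _) h
    exact ((hseq π hπ).inner (hseq ψ hψ)).congr fun k =>
      inner_riemannSum_riemannSum hH hP α (π k) (ψ k)
  · have hbound : ∀ V, (pVar p α).toReal < V → ‖I‖ ^ 2 ≤ C * V ^ 2 * T ^ (2 * H) := by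
      intro V hV
      have hle : pVar p α ≤ ENNReal.ofReal V :=
        (ENNReal.le_ofReal_iff_toReal_le hα.1 (ENNReal.toReal_nonneg.trans hV.le)).2 hV.le
      exact le_of_tendsto' (hI.norm.pow 2) fun π => norm_riemannSum_sq_le hH hP hH₂.le hp0
        (ENNReal.toReal_nonneg.trans_lt hV) hT hθ hle π
    have hlim : ‖I‖ ^ 2 ≤ C * (pVar p α).toReal ^ 2 * T ^ (2 * H) := by
      have hcont : Continuous fun V : ℝ => C * V ^ 2 * T ^ (2 * H) := by fun_prop
      exact ge_of_tendsto (hcont.continuousWithinAt (s := Set.Ioi (pVar p α).toReal))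
        (eventually_mem_nhdsWithin.mono fun V hV => hbound V hV)
    exact hlim.trans (mul_le_mul_of_nonneg_left (rpow_le_pVar2D_fbmCov hH hH₂.le hT)
      (by positivity))
  · intro s
    -- Pairing with $R(s,\cdot)$ is evaluation at $s$, and $R$ is symmetric.
    have h := hinner (covElem hH hP s)
    rw [real_inner_comm, inner_covElem] at h
    have e : (fun t : Set.Icc (0 : ℝ) T => fbmCov H t s)
        = CameronMartin.incl P (covElem hH hP s) := by
      funext t
      rw [incl_covElem]
      simp only [fbmCov]
      rw [abs_sub_comm (s : ℝ) t]
      ring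
    rw [e]
    exact h
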